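/- Let $X$ be a Fréchet space and $Y$ a separable Fréchet space (over the same field $\mathbb R$ or $\mathbb C$), and let $T_n: X\to Y$, $n\in\mathbb N=\{1,2,3,\dots\}$, be continuous linear operators. Suppose that $(T_n)$ satisfies the Frequent Universality Criterion: there are a dense subset $Y_0$ of $Y$ and mappings $S_n: Y_0\to X$, $n\in\mathbb N$, such that for every $y\in Y_0$ 1. $\sum_{1\le n<k} T_kS_{k-n}y$ converges unconditionally in $Y$, uniformly in $k\in\mathbb N$; 2. $\sum_{n\ge 1} T_kS_{k+n}y$ converges unconditionally in $Y$, uniformly in $k\in\mathbb N$; 3. $\sum_{n\ge 1} S_n y$ converges unconditionally in $X$; 4. $T_nS_ny\to y$ as $n\to\infty$. (Unconditional convergence, uniformly in $k$, of $\sum_n u_{n,k}$ means that the finite partial sums $\sum_{n\in F}u_{n,k}$ converge along the directed set of finite sets $F$ of indices, uniformly in $k$.) Then for every integer $s\ge 1$ the sequence $(T_n)$ is $\tilde D_s$-frequently universal. That is, let $\log^{(s)}$ be the $s$-fold iterate of $\log$ and let $(\alpha_k)_{k\ge1}$ be any sequence of non-negative reals with $\sum_k\alpha_k=+\infty$ and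 $\alpha_k=e^{k/\log^{(s)}(k)}$ for all large enough $k$. Then there is $x\in X$ such that for every non-empty open set $U\subset Y$ $$\liminf_{n\to\infty}\ \frac{\sum_{1\le k\le n,\ T_kx\in U}\alpha_k}{\sum_{k=1}^n\alpha_k}>0 .$$ -/

import Mathlib

open Filter Topology

noncomputable section

/-- A Fréchet space over `𝕜`: a complete Hausdorff topological vector space whose topology is
induced by a countable family of seminorms (the uniformity being the one of the additive group). -/
class IsFrechetSpace (𝕜 E : Type*) [RCLike 𝕜] [AddCommGroup E] [Module 𝕜 E] [UniformSpace E] :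
    Prop extends IsUniformAddGroup E, T2Space E, CompleteSpace E where
  exists_withSeminorms : ∃ p : ℕ → Seminorm 𝕜 E, WithSeminorms p

/-- The matrix `α_{n,k} = α_k / ∑_{j=1}^n α_j` for `1 ≤ k ≤ n`, and `0` otherwise. Only the
weights `α k` with `1 ≤ k` are used. -/
def admissibleMatrix (α : ℕ → ℝ) (n k : ℕ) : ℝ :=
  if 1 ≤ k ∧ k ≤ n then α k / ∑ j ∈ Finset.Icc 1 n, α j else 0

/-- The weights define an admissible matrix: `α_k ≥ 0` for `k ≥ 1` and `∑_{k ≥ 1} α_k = +∞`. -/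
def IsAdmissibleWeight (α : ℕ → ℝ) : Prop :=
  (∀ k, 1 ≤ k → 0 ≤ α k) ∧ Tendsto (fun n => ∑ j ∈ Finset.Icc 1 n, α j) atTop atTop

/-- The lower `A`-density `liminf_n ∑_{k ≥ 1} α_{n,k} 1_E(k)` of a set `E` of positive integers. -/
def lowerMatrixDensity (A : ℕ → ℕ → ℝ) (E : Set ℕ) : ℝ :=
  liminf (fun n => ∑' k : ℕ, A n (k + 1) * E.indicator 1 (k + 1)) atTop

/-- `α` is a sequence of weights for the matrix `D̃_s`: nonnegative, with divergent sum, and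
`α_k = exp (k / log^{(s)} k)` for all large enough `k`, where `log^{(s)}` is the `s`-fold iterate
of `log`. -/
def IsDTildeWeight (s : ℕ) (α : ℕ → ℝ) : Prop :=
  IsAdmissibleWeight α ∧ ∀ᶠ k : ℕ in atTop, α k = Real.exp ((k : ℝ) / (Real.log^[s] (k : ℝ)))

section Universality

variable {𝕜 X Y : Type*} [RCLike 𝕜] [AddCommGroup X] [Module 𝕜 X] [UniformSpace X]
  [AddCommGroup Y] [Module 𝕜 Y] [UniformSpace Y]

/-- The set `N(x, U)` of the positive integers `n` with `T_n x ∈ U`. -/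
def visitSet (T : ℕ → X →L[𝕜] Y) (x : X) (U : Set Y) : Set ℕ :=
  {n | 1 ≤ n ∧ T n x ∈ U}

/-- `(T_n)_{n ≥ 1}` is `A`-frequently universal: for some `x`, every `N(x, U)` with `U ⊆ Y` open
and nonempty has positive lower `A`-density. -/
def IsFrequentlyUniversal (A : ℕ → ℕ → ℝ) (T : ℕ → X →L[𝕜] Y) : Prop :=
  ∃ x : X, ∀ U : Set Y, IsOpen U → U.Nonempty → 0 < lowerMatrixDensity A (visitSet T x U)

/-- `(T_n)_{n ≥ 1}` satisfies the Frequent Universality Criterion. All indices are positive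
(`T 0` and `S 0` are never used), so that the first family of sums is
`∑_{1 ≤ n < k} T_k S_{k-n} y`. `SummableUniformlyOn f s` says that the finite partial sums
`∑_{n ∈ F} f n k` converge along the directed set of all finite sets `F`, uniformly in `k ∈ s`,
which is unconditional convergence, uniformly in `k`. -/
def SatisfiesFrequentUniversalityCriterion (T : ℕ → X →L[𝕜] Y) : Prop :=
  ∃ Y₀ : Set Y, Dense Y₀ ∧ ∃ S : ℕ → Y₀ → X, ∀ y : Y₀,
    SummableUniformlyOn (fun n k : ℕ => if 1 ≤ n ∧ n < k then T k (S (k - n) y) else 0)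
      {k | 1 ≤ k} ∧
    SummableUniformlyOn (fun n k : ℕ => if 1 ≤ n then T k (S (k + n) y) else 0) {k | 1 ≤ k} ∧
    Summable (fun n : ℕ => if 1 ≤ n then S n y else 0) ∧
    Tendsto (fun n => T n (S n y)) atTop (𝓝 (y : Y))

end Universality

end

/-! The vector is x = ∑_q ∑_{n ∈ E_q} S_n y_q, where (y_q) is a sequence in Y₀ with dense range
taking each of its values infinitely often. The criterion gives thresholds N_q beyond which tails of
its series are at most 4^{-q}. If each E_q lies in [N_q, ∞) and distinct points of E_p and E_q are
at least N_{max(p,q)} apart, then for n ∈ E_p every term of T_n x except T_n S_n y_p is negligible,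
so T_n x is within 5·2^{-p} of y_p (`exists_vector_of_separated`).

It remains to find such sets of positive lower density (`exists_separated_sets`). Besides
admissibility, only one property of the weights is needed: far out they at most double over any
fixed distance. Residue classes and periodic families of blocks then have nearly their natural
proportion of the weight. E_p is a residue class modulo a period M_p, minus, for each q > p,
periodic blocks covering the N_q-neighbourhood of the q-th class. The periods grow so fast that all
these removals together cost at most half of the lower bound for the p-th class. -/

/-! ### Weight of periodic sets -/

/-- A set of integers that is full in one out of `J` consecutive blocks of length `D` carries at
most the proportion `2 / J` of the total weight, if the weights vary little at scale `D * J`. -/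
theorem sum_block_le {α : ℕ → ℝ} (hα : ∀ k, 1 ≤ k → 0 ≤ α k) {D J c : ℕ} (hD : 0 < D)
    (hc : D * J < c) (hreg : ∀ k i, c ≤ k → i < J → α k ≤ 2 * α (k - D * i)) (n : ℕ) :
    J * ∑ k ∈ (Finset.Icc 1 n).filter (fun k => c ≤ k ∧ (k / D) % J = 0), α k
      ≤ 2 * ∑ k ∈ Finset.Icc 1 n, α k := by
  set F := (Finset.Icc 1 n).filter (fun k => c ≤ k ∧ (k / D) % J = 0) with hF
  have hlt : ∀ i, i < J → D * i < D * J := fun i hi => Nat.mul_lt_mul_of_pos_left hi hD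
  -- The translates of `F` by `D * i`, `i < J`, are disjoint: translating by `D * i` lowers the
  -- block index by `i`, and that index was 0 modulo `J`. Moving left keeps them inside [1, n], so
  -- there is no boundary error.
  have hinj : Set.InjOn (fun x : ℕ × ℕ => x.1 - D * x.2) (F ×ˢ Finset.range J : Finset (ℕ × ℕ)) := by
    rintro ⟨k, i⟩ h ⟨k', i'⟩ h' heq
    simp only [Finset.coe_product, Set.mem_prod, Finset.mem_coe, hF, Finset.mem_filter,
      Finset.mem_Icc, Finset.mem_range] at h h' heq
    obtain ⟨⟨_, hk, hkJ⟩, hi⟩ := h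
    obtain ⟨⟨_, hk', hkJ'⟩, hi'⟩ := h'
    have key : k + D * i' = k' + D * i := by
      have := hlt i hi
      have := hlt i' hi'
      omega
    have hdiv : k / D + i' = k' / D + i := by
      rw [← Nat.add_mul_div_left k i' hD, key, Nat.add_mul_div_left _ _ hD]
    have hi_eq : i = i' := by
      have h1 : (k / D + i') % J = i' := by
        rw [Nat.add_mod, hkJ, zero_add, Nat.mod_mod, Nat.mod_eq_of_lt hi']
      have h2 : (k' / D + i) % J = i := by
        rw [Nat.add_mod, hkJ', zero_add, Nat.mod_mod, Nat.mod_eq_of_lt hi]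
      rw [← h1, ← h2, hdiv]
    subst hi_eq
    simp only [Prod.mk.injEq, and_true]
    omega
  calc (J : ℝ) * ∑ k ∈ F, α k = ∑ x ∈ F ×ˢ Finset.range J, α x.1 := by
        rw [Finset.sum_product]
        simp [Finset.mul_sum]
    _ ≤ ∑ x ∈ F ×ˢ Finset.range J, 2 * α (x.1 - D * x.2) := by
        refine Finset.sum_le_sum fun x hx => ?_
        simp only [Finset.mem_product, hF, Finset.mem_filter, Finset.mem_range] at hx
        exact hreg _ _ hx.1.2.1 hx.2
    _ = 2 * ∑ k ∈ (F ×ˢ Finset.range J).image (fun x => x.1 - D * x.2), α k := by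
        rw [Finset.sum_image hinj, Finset.mul_sum]
    _ ≤ 2 * ∑ k ∈ Finset.Icc 1 n, α k := by
        refine mul_le_mul_of_nonneg_left ?_ zero_le_two
        refine Finset.sum_le_sum_of_subset_of_nonneg ?_ fun k hk _ => hα k (Finset.mem_Icc.1 hk).1
        intro k hk
        simp only [Finset.mem_image, Finset.mem_product, hF, Finset.mem_filter, Finset.mem_range,
          Finset.mem_Icc] at hk ⊢
        obtain ⟨⟨k, i⟩, ⟨⟨_, hk, _⟩, hi⟩, rfl⟩ := hk
        have := hlt i hi
        dsimp only at *
        omega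

/-- A residue class modulo `M` carries, up to finitely many terms, at least the proportion
`1 / (2 * M)` of the total weight, if the weights vary little at scale `M`. -/
theorem le_sum_residue {α : ℕ → ℝ} (hα : ∀ k, 1 ≤ k → 0 ≤ α k) {M r c : ℕ} (hr : r < M)
    (hc : 0 < c) (hreg : ∀ j k, c ≤ j → j ≤ k → k ≤ j + M → α k ≤ 2 * α j) (n : ℕ) :
    ∑ k ∈ Finset.Icc 1 n, α k - ∑ k ∈ Finset.Icc 1 (c + r + M), α k
      ≤ 2 * M * ∑ k ∈ (Finset.Icc 1 n).filter (fun k => c + r ≤ k ∧ k % M = r), α k := by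
  set G := (Finset.Icc 1 n).filter (fun k => c + r ≤ k ∧ k % M = r) with hG
  set I := Finset.Ioc (c + r + M) n with hI
  have h1 : ∑ k ∈ Finset.Icc 1 n, α k
      ≤ ∑ k ∈ Finset.Icc 1 (c + r + M), α k + ∑ k ∈ I, α k := by
    have hdisj : Disjoint (Finset.Icc 1 (c + r + M)) I := by
      rw [Finset.disjoint_left]
      intro k hk hk'
      simp only [hI, Finset.mem_Icc, Finset.mem_Ioc] at hk hk'
      omega
    rw [← Finset.sum_union hdisj]
    refine Finset.sum_le_sum_of_subset_of_nonneg ?_ fun k hk _ => hα k ?_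
    · intro k hk
      simp only [hI, Finset.mem_union, Finset.mem_Icc, Finset.mem_Ioc] at hk ⊢
      omega
    · simp only [hI, Finset.mem_union, Finset.mem_Icc, Finset.mem_Ioc] at hk
      omega
  have hmod : ∀ j, (j - r) % M < M := fun j => Nat.mod_lt _ (by omega)
  -- Each `j` is sent to the last point of the residue class not beyond it; a fibre has at most `M`
  -- points, each of weight at most twice that of its image.
  have hmaps : ∀ j ∈ I, j - (j - r) % M ∈ G := by
    intro j hj
    have := hmod j
    simp only [hI, hG, Finset.mem_filter, Finset.mem_Icc, Finset.mem_Ioc] at hj ⊢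
    refine ⟨by omega, by omega, ?_⟩
    have h2 := Nat.mod_add_div (j - r) M
    have h3 : j - (j - r) % M = r + M * ((j - r) / M) := by omega
    rw [h3, Nat.add_mul_mod_self_left, Nat.mod_eq_of_lt hr]
  have h2 : ∑ k ∈ I, α k ≤ 2 * M * ∑ k ∈ G, α k := by
    rw [← Finset.sum_fiberwise_of_maps_to hmaps, Finset.mul_sum]
    refine Finset.sum_le_sum fun k hk => ?_
    have hk' := hk
    simp only [hG, Finset.mem_filter, Finset.mem_Icc] at hk'
    have hsub : I.filter (fun j => j - (j - r) % M = k) ⊆ Finset.Ico k (k + M) := by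
      intro j hj
      have := hmod j
      simp only [hI, Finset.mem_filter, Finset.mem_Ioc, Finset.mem_Ico] at hj ⊢
      omega
    calc ∑ j ∈ I.filter (fun j => j - (j - r) % M = k), α j
        ≤ ∑ j ∈ I.filter (fun j => j - (j - r) % M = k), 2 * α k := by
          refine Finset.sum_le_sum fun j hj => ?_
          have := Finset.mem_Ico.1 (hsub hj)
          exact hreg k j (by omega) this.1 this.2.le
      _ ≤ M * (2 * α k) := by
          rw [Finset.sum_const, nsmul_eq_mul]
          refine mul_le_mul_of_nonneg_right ?_ (mul_nonneg zero_le_two (hα k hk'.1.1))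
          exact_mod_cast (Finset.card_le_card hsub).trans (by simp)
      _ = 2 * M * α k := by ring
  linarith

/-! ### Separated sets of positive lower density -/

/-- The periods of the residue classes used to build separated sets. -/
def sepPeriod (N : ℕ → ℕ) : ℕ → ℕ
  | 0 => 2 * N 0 * 32
  | q + 1 => 2 * N (q + 1) * (2 ^ (q + 6) * sepPeriod N q)

/-- The numbers of blocks of length `2 * N q` in a period. -/
def sepBlocks (N : ℕ → ℕ) : ℕ → ℕ
  | 0 => 32
  | q + 1 => 2 ^ (q + 6) * sepPeriod N q

theorem sepPeriod_eq (N : ℕ → ℕ) (q : ℕ) : sepPeriod N q = 2 * N q * sepBlocks N q := by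
  cases q <;> rfl

theorem sepPeriod_pos {N : ℕ → ℕ} (hN : ∀ p, 1 ≤ N p) (q : ℕ) : 0 < sepPeriod N q := by
  induction q with
  | zero => have := hN 0; simp only [sepPeriod]; omega
  | succ q ih => have := hN (q + 1); simp only [sepPeriod]; positivity

theorem sepBlocks_pos {N : ℕ → ℕ} (hN : ∀ p, 1 ≤ N p) (q : ℕ) : 0 < sepBlocks N q :=
  Nat.pos_of_mul_pos_left (sepPeriod_eq N q ▸ sepPeriod_pos hN q)

theorem sepPeriod_monotone {N : ℕ → ℕ} (hN : ∀ p, 1 ≤ N p) : Monotone (sepPeriod N) := by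
  refine monotone_nat_of_le_succ fun q => ?_
  have := hN (q + 1)
  simp only [sepPeriod]
  rw [← mul_assoc]
  exact Nat.le_mul_of_pos_left _ (by positivity)

/-- The blocks removed at stage `q` have proportion at most `2 / sepBlocks N q`. This bound makes it
small against `1 / sepPeriod N p` for all `p < q` at once, and summable in `q`. -/
theorem mul_sepPeriod_le_sepBlocks {N : ℕ → ℕ} (hN : ∀ p, 1 ≤ N p) {p q : ℕ} (h : p < q) :
    2 ^ (q + 5) * sepPeriod N p ≤ sepBlocks N q := by
  obtain ⟨q, rfl⟩ : ∃ r, q = r + 1 := ⟨q - 1, by omega⟩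
  exact Nat.mul_le_mul_left _ (sepPeriod_monotone hN (by omega))

theorem lt_sepPeriod {N : ℕ → ℕ} (hN : ∀ p, 1 ≤ N p) (q : ℕ) : N q < sepPeriod N q := by
  have h1 := hN q
  have h2 := sepBlocks_pos hN q
  rw [sepPeriod_eq]
  nlinarith

/-- Points of the residue class `N q` modulo `sepPeriod N q` forbid their `N q`-neighbourhood. -/
theorem div_mod_eq_zero_of_near {D J r m n : ℕ} (hD : D = 2 * r) (hr : 0 < r)
    (hm : m % (D * J) = r) (h1 : n < m + r) (h2 : m < n + r) : n / D % J = 0 := by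
  have h3 := Nat.mod_add_div m (D * J)
  rw [hm, mul_assoc] at h3
  set a := J * (m / (D * J)) with ha
  have hn : n / D = a := by
    rw [Nat.div_eq_iff (by omega)]
    rw [mul_comm] at h3
    constructor <;> omega
  rw [hn, ha, Nat.mul_mod_right]

/-- Conflicts between stages are settled in favour of the larger index: the sparser class `G q`
stays, and points of `G p`, `p < q`, in the blocks `F q` around it are dropped. -/
theorem exists_separated_sets {α : ℕ → ℝ} (hα : IsAdmissibleWeight α)
    (hreg : ∀ M, ∃ c, ∀ j k, c ≤ j → j ≤ k → k ≤ j + M → α k ≤ 2 * α j) {N : ℕ → ℕ}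
    (hN : ∀ p, 1 ≤ N p) :
    ∃ E : ℕ → Set ℕ, (∀ p, ∀ n ∈ E p, N p ≤ n) ∧
      (∀ p q, ∀ n ∈ E p, ∀ m ∈ E q, (p ≠ q ∨ n ≠ m) →
        n + N (max p q) ≤ m ∨ m + N (max p q) ≤ n) ∧
      ∀ p, ∃ δ > 0, ∀ᶠ n in atTop,
        δ * ∑ k ∈ Finset.Icc 1 n, α k ≤ ∑ k ∈ Finset.Icc 1 n, (E p).indicator α k := by
  classical
  choose c₀ hc₀ using fun q => hreg (sepPeriod N q)
  -- The summand `sepPeriod N q` leaves room for leftward shifts within one period; the summand `q`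
  -- makes `F q` miss [1, n] for `q ≥ n`, so only finitely many `q` matter for each `n`.
  set c : ℕ → ℕ := fun q => c₀ q + sepPeriod N q + q + 1
  have hc : ∀ q, c q = c₀ q + sepPeriod N q + q + 1 := fun _ => rfl
  set F : ℕ → Set ℕ := fun q => {k | c q ≤ k ∧ k / (2 * N q) % sepBlocks N q = 0} with hF
  set G : ℕ → Set ℕ := fun q => {k | c q + N q ≤ k ∧ k % sepPeriod N q = N q} with hG
  have hsep : ∀ p q n m, p < q → n ∈ G p → (∀ q, p < q → n ∉ F q) → m ∈ G q →
      n + N q ≤ m ∨ m + N q ≤ n := by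
    intro p q n m hpq _ hnF hm
    by_contra! hcon
    refine hnF q hpq ⟨?_, ?_⟩
    · have := hm.1
      omega
    · refine div_mod_eq_zero_of_near rfl (hN q) (m := m) ?_ hcon.2 hcon.1
      rw [← sepPeriod_eq]
      exact hm.2
  refine ⟨fun p => {k | k ∈ G p ∧ ∀ q, p < q → k ∉ F q}, ?_, ?_, ?_⟩
  · rintro p n ⟨hn, _⟩
    have := hn.1
    omega
  · rintro p q n ⟨hn, hn'⟩ m ⟨hm, hm'⟩ hne
    rcases lt_trichotomy p q with h | rfl | h
    · rw [max_eq_right h.le]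
      exact hsep p q n m h hn hn' hm
    · rw [max_self]
      have hne : n ≠ m := by simpa using hne
      have hlt := lt_sepPeriod hN p
      have key : ∀ a b : ℕ, a % sepPeriod N p = N p → b % sepPeriod N p = N p → a < b →
          a + N p ≤ b := by
        intro a b ha hb hab
        have h1 : sepPeriod N p ∣ b - a :=
          (Nat.modEq_iff_dvd' hab.le).1 (ha.trans hb.symm)
        have := Nat.le_of_dvd (by omega) h1
        omega
      rcases lt_or_gt_of_ne hne with h | h
      · exact Or.inl (key _ _ hn.2 hm.2 h)
      · exact Or.inr (key _ _ hm.2 hn.2 h)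
    · rw [max_eq_left h.le]
      exact (hsep q p m n h hm hm' hn).symm
  · intro p
    have hMpos : (0 : ℝ) < sepPeriod N p := by exact_mod_cast sepPeriod_pos hN p
    -- With M = `sepPeriod N p`, the class keeps 1/(4M) of the weight and the removals cost at most
    -- ∑_q 2^{-q}/(16M) ≤ 1/(8M).
    refine ⟨1 / (8 * sepPeriod N p), by positivity, ?_⟩
    have hcp := hc p
    set C := ∑ k ∈ Finset.Icc 1 (c p + N p + sepPeriod N p), α k
    -- Once the total weight is at least `2 * C`, the boundary term `C` costs only a factor 2.
    filter_upwards [hα.2.eventually_ge_atTop (2 * C)] with n hn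
    set A := ∑ k ∈ Finset.Icc 1 n, α k with hA
    have hA0 : 0 ≤ A := Finset.sum_nonneg fun k hk => hα.1 k (Finset.mem_Icc.1 hk).1
    have hlow : A / (4 * sepPeriod N p) ≤ ∑ k ∈ Finset.Icc 1 n, (G p).indicator α k := by
      have h := le_sum_residue hα.1 (c := c p) (lt_sepPeriod hN p) (by omega)
        (fun j k hj => hc₀ p j k (by omega)) n
      rw [Finset.sum_filter] at h
      have h' : ∑ k ∈ Finset.Icc 1 n, (G p).indicator α k = ∑ a ∈ Finset.Icc 1 n,
          if c p + N p ≤ a ∧ a % sepPeriod N p = N p then α a else 0 := by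
        simp only [Set.indicator_apply, hG, Set.mem_ofPred_eq]
      rw [h', div_le_iff₀ (by positivity)]
      change A - C ≤ _ at h
      linarith
    have hup : ∀ q, p < q → ∑ k ∈ Finset.Icc 1 n, (F q).indicator α k
        ≤ A / (16 * sepPeriod N p) * (1 / 2) ^ q := by
      intro q hpq
      have hM := sepPeriod_eq N q
      have hcq := hc q
      have h := sum_block_le hα.1 (D := 2 * N q) (J := sepBlocks N q) (c := c q)
        (by have := hN q; omega) (by omega) (fun k i hk hi => by
          have hlt : 2 * N q * i < 2 * N q * sepBlocks N q :=
            Nat.mul_lt_mul_of_pos_left hi (by have := hN q; omega)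
          exact hc₀ q _ _ (by omega) (by omega) (by omega)) n
      rw [Finset.sum_filter] at h
      have h' : ∑ k ∈ Finset.Icc 1 n, (F q).indicator α k = ∑ a ∈ Finset.Icc 1 n,
          if c q ≤ a ∧ a / (2 * N q) % sepBlocks N q = 0 then α a else 0 := by
        simp only [Set.indicator_apply, hF, Set.mem_ofPred_eq]
      rw [← h'] at h
      have hF0 : 0 ≤ ∑ k ∈ Finset.Icc 1 n, (F q).indicator α k :=
        Finset.sum_nonneg fun k hk =>
          Set.indicator_apply_nonneg fun _ => hα.1 k (Finset.mem_Icc.1 hk).1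
      have hJ : (2 : ℝ) ^ (q + 5) * sepPeriod N p ≤ sepBlocks N q := by
        exact_mod_cast mul_sepPeriod_le_sepBlocks hN hpq
      have h2 := (mul_le_mul_of_nonneg_right hJ hF0).trans h
      have hpow : (0 : ℝ) < 2 ^ q := by positivity
      rw [one_div, inv_pow, ← div_eq_mul_inv, div_div, le_div_iff₀ (by positivity)]
      rw [pow_add] at h2
      norm_num at h2
      linarith
    have hsplit : ∀ k ∈ Finset.Icc 1 n, (G p).indicator α k
        ≤ {k | k ∈ G p ∧ ∀ q, p < q → k ∉ F q}.indicator α k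
          + ∑ q ∈ Finset.Ioc p n, (F q).indicator α k := by
      intro k hk
      obtain ⟨hk1, hkn⟩ := Finset.mem_Icc.1 hk
      have hk0 := hα.1 k hk1
      have hnn : ∀ q, 0 ≤ (F q).indicator α k := fun q => Set.indicator_apply_nonneg fun _ => hk0
      by_cases hkG : k ∈ G p
      · by_cases hkF : ∀ q, p < q → k ∉ F q
        · rw [Set.indicator_of_mem hkG, Set.indicator_of_mem (show k ∈ {k | k ∈ G p ∧ ∀ q, p < q → k ∉ F q} from ⟨hkG, hkF⟩)]
          exact le_add_of_nonneg_right (Finset.sum_nonneg fun q _ => hnn q)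
        · push Not at hkF
          obtain ⟨q, hpq, hq⟩ := hkF
          have hqn : q ∈ Finset.Ioc p n := by
            have := hc q
            have := hq.1
            rw [Finset.mem_Ioc]
            omega
          have h1 := Finset.single_le_sum (f := fun q => (F q).indicator α k)
            (fun q _ => hnn q) hqn
          simp only [Set.indicator_of_mem hq] at h1
          rw [Set.indicator_of_mem hkG]
          exact h1.trans (le_add_of_nonneg_left (Set.indicator_apply_nonneg fun _ => hk0))
      · rw [Set.indicator_of_notMem hkG]
        exact add_nonneg (Set.indicator_apply_nonneg fun _ => hk0)
          (Finset.sum_nonneg fun q _ => hnn q)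
    have hsum := Finset.sum_le_sum hsplit
    rw [Finset.sum_add_distrib, Finset.sum_comm] at hsum
    have hgeom : ∑ q ∈ Finset.Ioc p n, A / (16 * sepPeriod N p) * (1 / 2 : ℝ) ^ q
        ≤ A / (16 * sepPeriod N p) * 2 := by
      rw [← Finset.mul_sum]
      refine mul_le_mul_of_nonneg_left ?_ (by positivity)
      exact (summable_geometric_two.sum_le_tsum _ fun _ _ => by positivity).trans_eq
        tsum_geometric_two
    have hF' := (Finset.sum_le_sum fun q hq => hup q (Finset.mem_Ioc.1 hq).1).trans hgeom
    have e1 : A / (4 * sepPeriod N p) = 1 / (8 * sepPeriod N p) * A * 2 := by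
      field_simp; ring
    have e2 : A / (16 * sepPeriod N p) * 2 = 1 / (8 * sepPeriod N p) * A := by
      field_simp; ring
    rw [e1] at hlow
    rw [e2] at hF'
    linarith

/-! ### Seminorms and tails of series -/

/-- Partial sums of a defining family are increasing and dominate its finite suprema. Monotonicity
lets an estimate at index `max p q` serve at index `p`. -/
theorem IsFrechetSpace.exists_monotone_seminorms (𝕜 E : Type*) [RCLike 𝕜] [AddCommGroup E]
    [Module 𝕜 E] [UniformSpace E] [IsFrechetSpace 𝕜 E] :
    ∃ Q : ℕ → Seminorm 𝕜 E, Monotone Q ∧ (∀ j, Continuous (Q j)) ∧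
      ∀ a : E, ∀ U ∈ 𝓝 a, ∃ j, ∃ r > 0, ∀ x, Q j (x - a) < r → x ∈ U := by
  obtain ⟨p, hp⟩ := IsFrechetSpace.exists_withSeminorms (𝕜 := 𝕜) (E := E)
  have happ : ∀ (s : Finset ℕ) (x : E), (∑ i ∈ s, p i) x = ∑ i ∈ s, p i x := by
    intro s x
    induction s using Finset.cons_induction with
    | empty => simp
    | cons a s ha ih => rw [Finset.sum_cons, Finset.sum_cons, add_apply, ih]
  refine ⟨fun j => ∑ i ∈ Finset.range (j + 1), p i, ?_, ?_, ?_⟩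
  · intro i j hij x
    simp only [happ]
    exact Finset.sum_le_sum_of_subset_of_nonneg (Finset.range_mono (by omega))
      fun _ _ _ => apply_nonneg _ _
  · intro j
    have h : Continuous fun x => ∑ i ∈ Finset.range (j + 1), p i x :=
      continuous_finsetSum _ fun i _ => hp.continuous_seminorm i
    exact h.congr fun x => (happ _ x).symm
  · intro a U hU
    obtain ⟨s, r, hr, hsU⟩ := (hp.mem_nhds_iff a U).1 hU
    refine ⟨s.sup id, r, hr, fun x hx => hsU ?_⟩
    rw [Seminorm.mem_ball]
    refine lt_of_le_of_lt ?_ hx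
    refine (Seminorm.finset_sup_le_sum p s (x - a)).trans ?_
    rw [happ, happ]
    refine Finset.sum_le_sum_of_subset_of_nonneg (fun i hi => ?_) fun _ _ _ => apply_nonneg _ _
    have : i ≤ s.sup id := Finset.le_sup (f := id) hi
    exact Finset.mem_range.2 (by omega)

section Seminorm

variable {𝕜 E : Type*} [RCLike 𝕜] [AddCommGroup E] [Module 𝕜 E]

theorem Seminorm.map_finsetSum_le {ι : Type*} (Q : Seminorm 𝕜 E) (s : Finset ι) (f : ι → E) :
    Q (∑ i ∈ s, f i) ≤ ∑ i ∈ s, Q (f i) :=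
  Finset.le_sum_of_subadditive Q (map_zero Q).le (map_add_le_add Q) s f

theorem Seminorm.exists_tail_le_of_summable [TopologicalSpace E] [IsTopologicalAddGroup E]
    {Q : Seminorm 𝕜 E} (hQ : Continuous Q) {f : ℕ → E} (hf : Summable f) {ε : ℝ} (hε : 0 < ε) :
    ∃ N, ∀ F : Finset ℕ, (∀ n ∈ F, N ≤ n) → Q (∑ n ∈ F, f n) ≤ ε := by
  have he : {x | Q x < ε} ∈ 𝓝 (0 : E) := (isOpen_lt hQ continuous_const).mem_nhds (by simpa)
  obtain ⟨s, hs⟩ := hf.vanishing he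
  refine ⟨s.sup id + 1, fun F hF => (hs F ?_).le⟩
  rw [Finset.disjoint_left]
  intro n hn hns
  have : n ≤ s.sup id := Finset.le_sup (f := id) hns
  have := hF n hn
  omega

theorem Seminorm.exists_tail_le_of_summableUniformlyOn [UniformSpace E] [IsUniformAddGroup E]
    {Q : Seminorm 𝕜 E} (hQ : Continuous Q) {f : ℕ → ℕ → E} {K : Set ℕ}
    (hf : SummableUniformlyOn f K) {ε : ℝ} (hε : 0 < ε) :
    ∃ N, ∀ F : Finset ℕ, (∀ n ∈ F, N ≤ n) → ∀ k ∈ K, Q (∑ n ∈ F, f n k) ≤ ε := by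
  obtain ⟨g, hg⟩ := hf.exists
  have hu := hg.tendstoUniformlyOn
  have he : {x : E × E | Q (x.2 - x.1) < ε / 2} ∈ uniformity E := by
    rw [uniformity_eq_comap_nhds_zero]
    exact ⟨{x | Q x < ε / 2}, (isOpen_lt hQ continuous_const).mem_nhds (by simpa),
      fun _ h => h⟩
  obtain ⟨s, hs⟩ := eventually_atTop.1 (hu _ he)
  refine ⟨s.sup id + 1, fun F hF k hk => ?_⟩
  have hdisj : Disjoint F s := by
    rw [Finset.disjoint_left]
    intro n hn hns
    have : n ≤ s.sup id := Finset.le_sup (f := id) hns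
    have := hF n hn
    omega
  have h1 : Q (∑ n ∈ F ∪ s, f n k - g k) < ε / 2 := hs _ Finset.subset_union_right k hk
  have h2 : Q (∑ n ∈ s, f n k - g k) < ε / 2 := hs s le_rfl k hk
  -- Cauchy criterion: a sum over `F` disjoint from `s` is a difference of two partial sums, both
  -- uniformly close to the limit `g`.
  have h3 : ∑ n ∈ F, f n k = (∑ n ∈ F ∪ s, f n k - g k) - (∑ n ∈ s, f n k - g k) := by
    rw [Finset.sum_union hdisj]
    abel
  rw [h3]
  exact (map_sub_le_add Q _ _).trans (by linarith)

theorem Seminorm.sub_le_of_hasSum [TopologicalSpace E] [IsTopologicalAddGroup E] {Q : Seminorm 𝕜 E}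
    (hQ : Continuous Q) {f : ℕ → E} {x : E} (hf : HasSum f x) (a : E) {ε : ℝ}
    (h : ∀ᶠ F : Finset ℕ in atTop, Q (∑ n ∈ F, f n - a) ≤ ε) : Q (x - a) ≤ ε :=
  le_of_tendsto (((hQ.comp (continuous_id.sub continuous_const)).tendsto x).comp hf) h

theorem summable_of_seminorm_le [UniformSpace E] [IsUniformAddGroup E] [CompleteSpace E]
    {Q : ℕ → Seminorm 𝕜 E}
    (hQ : ∀ U ∈ 𝓝 (0 : E), ∃ j, ∃ r > 0, ∀ x, Q j (x - 0) < r → x ∈ U)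
    {b : ℕ → ℝ} (hb : Summable b) {x : ℕ → E} (hx : ∀ j q, j ≤ q → Q j (x q) ≤ b q) :
    Summable x := by
  rw [summable_iff_vanishing]
  intro e he
  obtain ⟨j, r, hr, hU⟩ := hQ e he
  obtain ⟨s, hs⟩ := hb.vanishing (Metric.ball_mem_nhds 0 hr)
  -- `Q j` is controlled only on terms of index at least `j`; the finitely many others are
  -- discarded.
  refine ⟨s ∪ Finset.range j, fun t ht => hU _ ?_⟩
  rw [sub_zero]
  rw [Finset.disjoint_union_right] at ht
  have h1 := hs t ht.1
  rw [mem_ball_zero_iff, Real.norm_eq_abs] at h1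
  refine lt_of_le_of_lt ?_ ((le_abs_self _).trans_lt h1)
  refine ((Q j).map_finsetSum_le t x).trans (Finset.sum_le_sum fun q hq => hx j q ?_)
  have := Finset.disjoint_left.1 ht.2 hq
  rw [Finset.mem_range] at this
  omega

end Seminorm

/-! ### Construction of the vector -/

section Construction

variable {𝕜 X Y : Type*} [RCLike 𝕜] [AddCommGroup X] [Module 𝕜 X] [UniformSpace X]
  [AddCommGroup Y] [Module 𝕜 Y] [UniformSpace Y]

/-- A finite sum of `T n (u m)` over indices `m` far from `n` is small. -/
theorem seminorm_sum_far_le {T : ℕ → X →L[𝕜] Y} {R : Seminorm 𝕜 Y} {u : ℕ → X} {N : ℕ} {ε : ℝ}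
    (h1 : ∀ F : Finset ℕ, (∀ n ∈ F, N ≤ n) → ∀ k ∈ {k | 1 ≤ k},
      R (∑ n ∈ F, if 1 ≤ n ∧ n < k then T k (u (k - n)) else 0) ≤ ε)
    (h2 : ∀ F : Finset ℕ, (∀ n ∈ F, N ≤ n) → ∀ k ∈ {k | 1 ≤ k},
      R (∑ n ∈ F, if 1 ≤ n then T k (u (k + n)) else 0) ≤ ε)
    {n : ℕ} (hn : 1 ≤ n) (hN : 1 ≤ N) {G : Finset ℕ}
    (hG : ∀ m ∈ G, 1 ≤ m ∧ (n + N ≤ m ∨ m + N ≤ n)) :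
    R (∑ m ∈ G, T n (u m)) ≤ 2 * ε := by
  -- Indices below `n` belong to the first series of the criterion, via j = n - m, and those above
  -- to the second, via j = m - n.
  rw [← Finset.sum_filter_add_sum_filter_not G (fun m => m < n)]
  have e1 : ∑ m ∈ G with m < n, T n (u m) = ∑ j ∈ (G.filter (· < n)).image (fun m => n - m),
      if 1 ≤ j ∧ j < n then T n (u (n - j)) else 0 := by
    rw [Finset.sum_image]
    · refine Finset.sum_congr rfl fun m hm => ?_
      obtain ⟨hmG, hlt⟩ := Finset.mem_filter.1 hm
      have := hG m hmG
      rw [if_pos (by omega), Nat.sub_sub_self hlt.le]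
    · intro a ha b hb hab
      have ha := (Finset.mem_filter.1 ha).2
      have hb := (Finset.mem_filter.1 hb).2
      dsimp only at hab
      omega
  have e2 : ∑ m ∈ G with ¬ m < n, T n (u m)
      = ∑ j ∈ (G.filter (¬ · < n)).image (fun m => m - n),
        if 1 ≤ j then T n (u (n + j)) else 0 := by
    rw [Finset.sum_image]
    · refine Finset.sum_congr rfl fun m hm => ?_
      obtain ⟨hmG, hlt⟩ := Finset.mem_filter.1 hm
      have := hG m hmG
      rw [if_pos (by omega), Nat.add_sub_cancel' (by omega)]
    · intro a ha b hb hab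
      have ha := (Finset.mem_filter.1 ha).2
      have hb := (Finset.mem_filter.1 hb).2
      dsimp only at hab
      omega
  have b1 : R (∑ m ∈ G with m < n, T n (u m)) ≤ ε := by
    rw [e1]
    refine h1 _ (fun j hj => ?_) n hn
    obtain ⟨m, hm, rfl⟩ := Finset.mem_image.1 hj
    obtain ⟨hmG, hlt⟩ := Finset.mem_filter.1 hm
    have := hG m hmG
    omega
  have b2 : R (∑ m ∈ G with ¬ m < n, T n (u m)) ≤ ε := by
    rw [e2]
    refine h2 _ (fun j hj => ?_) n hn
    obtain ⟨m, hm, rfl⟩ := Finset.mem_image.1 hj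
    obtain ⟨hmG, hlt⟩ := Finset.mem_filter.1 hm
    have := hG m hmG
    omega
  exact (map_add_le_add R _ _).trans (by linarith)

/-- Error budget at `n ∈ E p`: the far terms from `E q` contribute at most 2·2^{-p}·2^{-q}, which
sums to 4·2^{-p}, and the diagonal term T_n S_n y_p adds at most 2^{-p}. -/
theorem exists_vector_of_separated [IsFrechetSpace 𝕜 X] [IsUniformAddGroup Y]
    {T : ℕ → X →L[𝕜] Y} {Q : ℕ → Seminorm 𝕜 X} (hQc : ∀ j, Continuous (Q j)) (hQm : Monotone Q)
    (hQ : ∀ U ∈ 𝓝 (0 : X), ∃ j, ∃ r > 0, ∀ x, Q j (x - 0) < r → x ∈ U)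
    {R : ℕ → Seminorm 𝕜 Y} (hRc : ∀ j, Continuous (R j)) (hRm : Monotone R)
    {u : ℕ → ℕ → X} {y : ℕ → Y} {N : ℕ → ℕ} (hN : ∀ p, 1 ≤ N p)
    (hsum : ∀ q, Summable fun n => if 1 ≤ n then u q n else 0)
    (h1 : ∀ p, ∀ i ≤ p, ∀ F : Finset ℕ, (∀ n ∈ F, N p ≤ n) → ∀ k ∈ {k | 1 ≤ k},
      R p (∑ n ∈ F, if 1 ≤ n ∧ n < k then T k (u i (k - n)) else 0) ≤ (1 / 4) ^ p)
    (h2 : ∀ p, ∀ i ≤ p, ∀ F : Finset ℕ, (∀ n ∈ F, N p ≤ n) → ∀ k ∈ {k | 1 ≤ k},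
      R p (∑ n ∈ F, if 1 ≤ n then T k (u i (k + n)) else 0) ≤ (1 / 4) ^ p)
    (h3 : ∀ p, ∀ F : Finset ℕ, (∀ n ∈ F, N p ≤ n) →
      Q p (∑ n ∈ F, if 1 ≤ n then u p n else 0) ≤ (1 / 4) ^ p)
    (h4 : ∀ p n, N p ≤ n → R p (T n (u p n) - y p) ≤ (1 / 4) ^ p)
    {E : ℕ → Set ℕ} (hE : ∀ p, ∀ n ∈ E p, N p ≤ n)
    (hsep : ∀ p q, ∀ n ∈ E p, ∀ m ∈ E q, (p ≠ q ∨ n ≠ m) →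
      n + N (max p q) ≤ m ∨ m + N (max p q) ≤ n) :
    ∃ x : X, ∀ p, ∀ n ∈ E p, R p (T n x - y p) ≤ 5 * (1 / 2) ^ p := by
  classical
  have hE1 : ∀ p, ∀ n ∈ E p, 1 ≤ n := fun p n hn => (hN p).trans (hE p n hn)
  set f : ℕ → ℕ → X := fun q => (E q).indicator (u q) with hf
  have hfeq : ∀ q, f q = (E q).indicator fun n => if 1 ≤ n then u q n else 0 := by
    intro q
    ext n
    by_cases hn : n ∈ E q
    · simp [hf, hn, hE1 q n hn]
    · simp [hf, hn]
  have hfs : ∀ q, Summable (f q) := fun q => by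
    rw [hfeq]
    exact (hsum q).indicator _
  have hxq : ∀ j q, j ≤ q → Q j (∑' n, f q n) ≤ (1 / 4) ^ q := by
    intro j q hjq
    refine (hQm hjq _).trans ?_
    rw [← sub_zero (∑' n, f q n)]
    refine Seminorm.sub_le_of_hasSum (hQc q) (hfs q).hasSum 0 (Eventually.of_forall fun F => ?_)
    rw [sub_zero, hfeq, Finset.sum_indicator_eq_sum_filter]
    exact h3 q _ fun n hn => hE q n (Finset.mem_filter.1 hn).2
  have hxs : Summable fun q => ∑' n, f q n :=
    summable_of_seminorm_le hQ
      (summable_geometric_of_lt_one (r := (1 / 4 : ℝ)) (by norm_num) (by norm_num)) hxq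
  refine ⟨∑' q, ∑' n, f q n, fun p n hn => ?_⟩
  have hfar : ∀ q, ∀ G : Finset ℕ, (∀ m ∈ G, m ∈ E q ∧ (p ≠ q ∨ n ≠ m)) →
      R p (∑ m ∈ G, T n (u q m)) ≤ 2 * ((1 / 2) ^ p * (1 / 2) ^ q) := by
    intro q G hG
    refine (hRm (le_max_left p q) _).trans ?_
    refine (seminorm_sum_far_le (h1 _ q (le_max_right p q)) (h2 _ q (le_max_right p q))
      (hE1 p n hn) (hN _) fun m hm => ⟨hE1 q m (hG m hm).1,
        hsep p q n hn m (hG m hm).1 (hG m hm).2⟩).trans ?_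
    refine mul_le_mul_of_nonneg_left ?_ zero_le_two
    -- 4^{-max(p,q)} ≤ 2^{-p}·2^{-q} because 2·max(p,q) ≥ p + q.
    rw [← pow_add, show (1 / 4 : ℝ) = (1 / 2) ^ 2 by norm_num, ← pow_mul]
    exact pow_le_pow_of_le_one (by norm_num) (by norm_num) (by omega)
  have hterm : ∀ q, R p (T n (∑' m, f q m) - if q = p then y p else 0)
      ≤ 2 * ((1 / 2) ^ p * (1 / 2) ^ q) + if q = p then (1 / 2) ^ p else 0 := by
    intro q
    refine Seminorm.sub_le_of_hasSum (hRc p) ((T n).hasSum (hfs q).hasSum) _ ?_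
    -- Partial sums are taken over `F` containing `n`, so that the diagonal term is present when `q
    -- = p`.
    filter_upwards [eventually_ge_atTop {n}] with F hF
    have hF' : ∑ m ∈ F, T n (f q m) = ∑ m ∈ F with m ∈ E q, T n (u q m) := by
      rw [← map_sum, ← map_sum, hf, Finset.sum_indicator_eq_sum_filter]
    rw [hF']
    split_ifs with hqp
    · subst hqp
      have hnF : n ∈ F.filter (· ∈ E q) :=
        Finset.mem_filter.2 ⟨hF (Finset.mem_singleton_self n), hn⟩
      rw [← Finset.add_sum_erase _ _ hnF, add_sub_right_comm]
      refine (map_add_le_add (R q) _ _).trans ?_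
      rw [add_comm]
      refine add_le_add (hfar q _ fun m hm => ?_) ((h4 q n (hE q n hn)).trans ?_)
      · obtain ⟨hne, hm⟩ := Finset.mem_erase.1 hm
        exact ⟨(Finset.mem_filter.1 hm).2, Or.inr hne.symm⟩
      · exact pow_le_pow_left₀ (by norm_num) (by norm_num) q
    · rw [sub_zero, add_zero]
      exact hfar q _ fun m hm => ⟨(Finset.mem_filter.1 hm).2, Or.inl (Ne.symm hqp)⟩
  refine Seminorm.sub_le_of_hasSum (hRc p) ((T n).hasSum hxs.hasSum) _ ?_
  filter_upwards [eventually_ge_atTop {p}] with F hF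
  have hpF : p ∈ F := hF (Finset.mem_singleton_self p)
  have hy : y p = ∑ q ∈ F, if q = p then y p else 0 := by
    rw [Finset.sum_ite_eq' F p, if_pos hpF]
  rw [hy, ← Finset.sum_sub_distrib]
  refine ((R p).map_finsetSum_le F _).trans ((Finset.sum_le_sum fun q _ => hterm q).trans ?_)
  rw [Finset.sum_add_distrib, Finset.sum_ite_eq' F p, if_pos hpF, ← Finset.mul_sum,
    ← Finset.mul_sum]
  have hg : ∑ q ∈ F, (1 / 2 : ℝ) ^ q ≤ 2 := by
    exact (summable_geometric_two.sum_le_tsum _ fun _ _ => by positivity).trans_eq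
      tsum_geometric_two
  have := mul_le_mul_of_nonneg_left hg (show (0 : ℝ) ≤ (1 / 2) ^ p by positivity)
  linarith

end Construction

/-! ### Slow variation of the weights -/

theorem tendsto_iterate_log_atTop (s : ℕ) : Tendsto Real.log^[s] atTop atTop := by
  induction s with
  | zero => exact tendsto_id
  | succ s ih =>
    rw [Function.iterate_succ']
    exact Real.tendsto_log_atTop.comp ih

theorem exists_monotoneOn_iterate_log (s : ℕ) : ∃ a, MonotoneOn Real.log^[s] (Set.Ici a) := by
  induction s with
  | zero => exact ⟨0, monotone_id.monotoneOn _⟩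
  | succ s ih =>
    obtain ⟨a, ha⟩ := ih
    obtain ⟨b, hb⟩ := eventually_atTop.1 ((tendsto_iterate_log_atTop s).eventually_gt_atTop 0)
    refine ⟨max a b, fun x hx y hy hxy => ?_⟩
    rw [Function.iterate_succ', Function.comp_apply, Function.comp_apply]
    exact Real.log_le_log (hb x ((le_max_right a b).trans hx))
      (ha ((le_max_left a b).trans hx) ((le_max_left a b).trans hy) hxy)

/-- The weights of `D̃_s` at most double over any fixed distance, far enough out. -/
theorem IsDTildeWeight.exists_le_two_mul {s : ℕ} {α : ℕ → ℝ} (hα : IsDTildeWeight s α) (M : ℕ) :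
    ∃ c, ∀ j k, c ≤ j → j ≤ k → k ≤ j + M → α k ≤ 2 * α j := by
  obtain ⟨a, ha⟩ := exists_monotoneOn_iterate_log s
  obtain ⟨c₁, hc₁⟩ := eventually_atTop.1 hα.2
  have hlog2 : 0 < Real.log 2 := Real.log_pos one_lt_two
  -- This threshold makes M / log^{(s)} j at most log 2, which bounds the growth of the exponent
  -- from `j` to `k`; the `+ 1` keeps log^{(s)} j positive even when `M = 0`.
  obtain ⟨c₂, hc₂⟩ := eventually_atTop.1 (((tendsto_iterate_log_atTop s).comp
    tendsto_natCast_atTop_atTop).eventually_ge_atTop (M / Real.log 2 + 1))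
  obtain ⟨c₃, hc₃⟩ := exists_nat_ge a
  refine ⟨max c₁ (max c₂ c₃), fun j k hj hjk hkM => ?_⟩
  simp only [max_le_iff] at hj
  obtain ⟨hj1, hj2, hj3⟩ := hj
  rw [hc₁ j hj1, hc₁ k (hj1.trans hjk)]
  have hjk' : (j : ℝ) ≤ k := by exact_mod_cast hjk
  have haj : a ≤ j := hc₃.trans (by exact_mod_cast hj3)
  have hL : Real.log^[s] (j : ℝ) ≤ Real.log^[s] (k : ℝ) := ha haj (haj.trans hjk') hjk'
  have hLj : M / Real.log 2 + 1 ≤ Real.log^[s] (j : ℝ) := hc₂ j hj2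
  have hM0 : 0 ≤ M / Real.log 2 := by positivity
  have hpos : 0 < Real.log^[s] (j : ℝ) := by linarith
  rw [← Real.exp_log (zero_lt_two' ℝ), ← Real.exp_add, Real.exp_le_exp]
  have hk : (k : ℝ) ≤ M + j := by
    rw [add_comm]
    exact_mod_cast hkM
  calc (k : ℝ) / Real.log^[s] (k : ℝ) ≤ k / Real.log^[s] (j : ℝ) :=
        div_le_div_of_nonneg_left (Nat.cast_nonneg k) hpos hL
    _ ≤ (M + j) / Real.log^[s] (j : ℝ) := div_le_div_of_nonneg_right hk hpos.le
    _ = M / Real.log^[s] (j : ℝ) + j / Real.log^[s] (j : ℝ) := add_div _ _ _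
    _ ≤ Real.log 2 + j / Real.log^[s] (j : ℝ) := by
        gcongr
        rw [div_le_iff₀ hpos, ← div_le_iff₀' hlog2]
        linarith

/-! ### Lower densities and conclusion -/

theorem tsum_admissibleMatrix_mul_indicator (α : ℕ → ℝ) (E : Set ℕ) (n : ℕ) :
    ∑' k : ℕ, admissibleMatrix α n (k + 1) * E.indicator 1 (k + 1)
      = (∑ k ∈ Finset.Icc 1 n, E.indicator α k) / ∑ k ∈ Finset.Icc 1 n, α k := by
  classical
  rw [tsum_eq_sum (s := Finset.range n)]
  · rw [Finset.sum_div, Finset.range_eq_Ico,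
      Finset.sum_Ico_add' (fun k => admissibleMatrix α n k * E.indicator 1 k) 0 n 1]
    refine Finset.sum_congr (by ext; simp) fun k hk => ?_
    have hk' : 1 ≤ k ∧ k ≤ n := by simp at hk; omega
    by_cases h : k ∈ E <;> simp [admissibleMatrix, hk', h]
  · intro k hk
    have : ¬ k + 1 ≤ n := by simpa using hk
    simp only [admissibleMatrix, this, and_false, if_false, zero_mul]

theorem lowerMatrixDensity_pos {α : ℕ → ℝ} (hα : IsAdmissibleWeight α) {E E' : Set ℕ}
    (hE : E ⊆ E') {δ : ℝ} (hδ : 0 < δ) (h : ∀ᶠ n in atTop,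
      δ * ∑ k ∈ Finset.Icc 1 n, α k ≤ ∑ k ∈ Finset.Icc 1 n, E.indicator α k) :
    0 < lowerMatrixDensity (admissibleMatrix α) E' := by
  refine hδ.trans_le ?_
  unfold lowerMatrixDensity
  simp only [tsum_admissibleMatrix_mul_indicator]
  have hpos := hα.2.eventually_gt_atTop 0
  refine le_liminf_of_le ?_ ?_
  -- The ratios are at most 1; without such a bound a real `liminf` could take its default value.
  · refine IsBoundedUnder.isCoboundedUnder_ge ⟨1, eventually_map.2 ?_⟩
    filter_upwards [hpos] with n hn
    rw [div_le_one hn]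
    exact Finset.sum_le_sum fun k hk =>
      Set.indicator_le_self' (fun _ _ => hα.1 k (Finset.mem_Icc.1 hk).1) k
  · filter_upwards [hpos, h] with n hn hle
    rw [le_div_iff₀ hn]
    refine hle.trans (Finset.sum_le_sum fun k hk => ?_)
    by_cases hk' : k ∈ E
    · rw [Set.indicator_of_mem hk', Set.indicator_of_mem (hE hk')]
    · rw [Set.indicator_of_notMem hk']
      exact Set.indicator_apply_nonneg fun _ => hα.1 k (Finset.mem_Icc.1 hk).1

/-- A dense subset of a separable Fréchet space has a dense sequence in which every term occurs
infinitely often. -/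
theorem exists_seq_frequently_near (𝕜 : Type*) {Y : Type*} [RCLike 𝕜] [AddCommGroup Y] [Module 𝕜 Y]
    [UniformSpace Y] [IsFrechetSpace 𝕜 Y] [TopologicalSpace.SeparableSpace Y] {Y₀ : Set Y}
    (hY₀ : Dense Y₀) :
    ∃ y : ℕ → Y₀, ∀ U : Set Y, IsOpen U → U.Nonempty →
      ∃ a ∈ U, ∃ᶠ p in atTop, (y p : Y) = a := by
  obtain ⟨p, hp⟩ := IsFrechetSpace.exists_withSeminorms (𝕜 := 𝕜) (E := Y)
  have := hp.firstCountableTopology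
  have : (uniformity Y).IsCountablyGenerated := IsUniformAddGroup.uniformity_countably_generated
  have := UniformSpace.secondCountable_of_separable Y
  have : Nonempty Y₀ := hY₀.nonempty.to_subtype
  obtain ⟨d, hd⟩ := TopologicalSpace.exists_dense_seq Y₀
  refine ⟨fun p => d p.unpair.1, fun U hU hne => ?_⟩
  obtain ⟨b, hbU, hb⟩ := hY₀.inter_open_nonempty U hU hne
  obtain ⟨_, ha, ⟨i, rfl⟩⟩ := hd.inter_open_nonempty _ (hU.preimage continuous_subtype_val)
    ⟨⟨b, hb⟩, hbU⟩
  refine ⟨d i, ha, frequently_atTop.2 fun n => ⟨Nat.pair i n, Nat.right_le_pair i n, ?_⟩⟩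
  simp

theorem mainTheorem1 {𝕜 X Y : Type*} [RCLike 𝕜]
    [AddCommGroup X] [Module 𝕜 X] [UniformSpace X] [IsFrechetSpace 𝕜 X]
    [AddCommGroup Y] [Module 𝕜 Y] [UniformSpace Y] [IsFrechetSpace 𝕜 Y]
    [TopologicalSpace.SeparableSpace Y]
    (T : ℕ → X →L[𝕜] Y) (hT : SatisfiesFrequentUniversalityCriterion T)
    (s : ℕ) (hs : 1 ≤ s) (α : ℕ → ℝ) (hα : IsDTildeWeight s α) :
    IsFrequentlyUniversal (admissibleMatrix α) T := by
  obtain ⟨Y₀, hY₀, S, hS⟩ := hT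
  obtain ⟨y, hy⟩ := exists_seq_frequently_near 𝕜 hY₀
  obtain ⟨Q, hQm, hQc, hQ⟩ := IsFrechetSpace.exists_monotone_seminorms 𝕜 X
  obtain ⟨R, hRm, hRc, hR⟩ := IsFrechetSpace.exists_monotone_seminorms 𝕜 Y
  have hε : ∀ p : ℕ, (0 : ℝ) < (1 / 4) ^ p := fun p => by positivity
  choose N₁ hN₁ using fun p i =>
    Seminorm.exists_tail_le_of_summableUniformlyOn (hRc p) (hS (y i)).1 (hε p)
  choose N₂ hN₂ using fun p i =>
    Seminorm.exists_tail_le_of_summableUniformlyOn (hRc p) (hS (y i)).2.1 (hε p)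
  choose N₃ hN₃ using fun p =>
    Seminorm.exists_tail_le_of_summable (hQc p) (hS (y p)).2.2.1 (hε p)
  have h4 : ∀ p, ∃ N, ∀ n, N ≤ n → R p (T n (S n (y p)) - y p) ≤ (1 / 4) ^ p := by
    intro p
    have hopen : {x | R p (x - y p) < (1 / 4) ^ p} ∈ 𝓝 (y p : Y) :=
      (isOpen_lt ((hRc p).comp (continuous_id.sub continuous_const)) continuous_const).mem_nhds
        (by simp)
    obtain ⟨N, hN⟩ := eventually_atTop.1 ((hS (y p)).2.2.2.eventually_mem hopen)
    exact ⟨N, fun n hn => (hN n hn).le⟩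
  choose N₄ hN₄ using h4
  -- `N p` must serve all of y_0, …, y_p, since at a point of `E p` the terms from `E q` with `q ≤
  -- p` are estimated with threshold `N p`.
  set N : ℕ → ℕ := fun p => ∑ i ∈ Finset.range (p + 1), (N₁ p i + N₂ p i) + N₃ p + N₄ p + 1 with hN
  have hle : ∀ p, ∀ i ≤ p, N₁ p i + N₂ p i ≤ N p := by
    intro p i hi
    have := Finset.single_le_sum (f := fun i => N₁ p i + N₂ p i) (fun _ _ => Nat.zero_le _)
      (show i ∈ Finset.range (p + 1) from Finset.mem_range.2 (by omega))
    simp only [hN]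
    omega
  have hN1 : ∀ p, 1 ≤ N p := fun p => by simp only [hN]; omega
  have hle3 : ∀ p, N₃ p ≤ N p := fun p => by simp only [hN]; omega
  have hle4 : ∀ p, N₄ p ≤ N p := fun p => by simp only [hN]; omega
  obtain ⟨E, hE, hsep, hdens⟩ :=
    exists_separated_sets hα.1 hα.exists_le_two_mul hN1
  obtain ⟨x, hx⟩ := exists_vector_of_separated (T := T) (u := fun q n => S n (y q))
    (y := fun p => (y p : Y)) hQc hQm (hQ 0) hRc hRm hN1 (fun q => (hS (y q)).2.2.1)
    (fun p i hi F hF => hN₁ p i F fun n hn => by have := hF n hn; have := hle p i hi; omega)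
    (fun p i hi F hF => hN₂ p i F fun n hn => by have := hF n hn; have := hle p i hi; omega)
    (fun p F hF => hN₃ p F fun n hn => (hle3 p).trans (hF n hn))
    (fun p n hn => hN₄ p n ((hle4 p).trans hn)) hE hsep
  refine ⟨x, fun U hU hne => ?_⟩
  obtain ⟨a, ha, hfreq⟩ := hy U hU hne
  obtain ⟨j, r, hr, hjU⟩ := hR a U (hU.mem_nhds ha)
  have hlim : Tendsto (fun p : ℕ => 5 * (1 / 2 : ℝ) ^ p) atTop (𝓝 0) := by
    simpa using (tendsto_pow_atTop_nhds_zero_of_lt_one (r := (1 / 2 : ℝ)) (by norm_num)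
      (by norm_num)).const_mul 5
  -- Since `a` recurs in the sequence, `p` can be taken large enough for the error 5·2^{-p} and the
  -- seminorm index to suit `U`.
  obtain ⟨p, hpa, hpr, hjp⟩ :=
    (hfreq.and_eventually ((hlim.eventually_lt_const hr).and (eventually_ge_atTop j))).exists
  obtain ⟨δ, hδ, hev⟩ := hdens p
  refine lowerMatrixDensity_pos hα.1 (fun n hn => ⟨(hN1 p).trans (hE p n hn), hjU _ ?_⟩) hδ hev
  have := hx p n hn
  rw [hpa] at this
  exact (hRm hjp _).trans_lt (this.trans_lt hpr)
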